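/- Let $r\ge s\ge 1$ be integers and let \[D=\langle x,y\mid x^{2^r}=y^{2^s}=[x,y]^2=[x,[x,y]]=[y,[x,y]]=1\rangle,\qquad [a,b]:=aba^{-1}b^{-1},\] which is a finite $2$-group (a minimal nonabelian group). Let $\mathcal{F}$ be a saturated fusion system on $D$ (at the prime $2$). (1) $\mathcal{F}$ is nilpotent, or $s=1$, or $r=s$. Here $\mathcal F$ is called nilpotent if $\mathcal{F}=\mathcal{F}_D(D)$, i.e. if every morphism of $\mathcal F$ is induced by conjugation with an element of $D$. (2) If $r=s\ge 2$, then $\mathcal{F}$ is controlled by $D$, i.e. every morphism $Q\to R$ in $\mathcal{F}$ between subgroups $Q,R\le D$ is the restriction of an automorphism of $D$ belonging to $\operatorname{Aut}_{\mathcal{F}}(D)$. -/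

import Mathlib

open scoped commutatorElement in
/-- The group `⟨x, y ∣ x^(2^r) = y^(2^s) = [x,y]^2 = [x,[x,y]] = [y,[x,y]] = 1⟩`, with
`[a,b] = a b a⁻¹ b⁻¹` (this is Mathlib's `⁅a, b⁆`), where `x`, `y` are the free generators
`0`, `1`. -/
abbrev RedeiGroup (r s : ℕ) : Type :=
  let x : FreeGroup (Fin 2) := FreeGroup.of 0
  let y : FreeGroup (Fin 2) := FreeGroup.of 1
  PresentedGroup ({x ^ 2 ^ r, y ^ 2 ^ s, ⁅x, y⁆ ^ 2, ⁅x, ⁅x, y⁆⁆, ⁅y, ⁅x, y⁆⁆} :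
    Set (FreeGroup (Fin 2)))

/-- A (not necessarily saturated) fusion system on a group `P`: a category whose objects are the
subgroups of `P`, whose morphisms are injective group homomorphisms (composed as maps), which
contains all homomorphisms induced by conjugation in `P` (in particular inclusions and identities),
and in which every morphism is an isomorphism of the category followed by an inclusion. -/
@[ext]
structure FusionSystem (P : Type*) [Group P] where
  /-- the set of morphisms from `Q` to `R` -/
  Hom : (Q R : Subgroup P) → Set (Q →* R)
  injective : ∀ {Q R : Subgroup P} {φ : Q →* R}, φ ∈ Hom Q R → Function.Injective φ
  conj_mem : ∀ {Q R : Subgroup P} (φ : Q →* R) (g : P),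
    (∀ u : Q, (φ u : P) = g * u * g⁻¹) → φ ∈ Hom Q R
  comp_mem : ∀ {Q R S : Subgroup P} {φ : Q →* R} {ψ : R →* S},
    φ ∈ Hom Q R → ψ ∈ Hom R S → ψ.comp φ ∈ Hom Q S
  factor : ∀ {Q R : Subgroup P} {φ : Q →* R}, φ ∈ Hom Q R →
    ∃ (S : Subgroup P) (hS : S ≤ R) (e : Q ≃* S),
      e.toMonoidHom ∈ Hom Q S ∧ e.symm.toMonoidHom ∈ Hom S Q ∧
        φ = (Subgroup.inclusion hS).comp e.toMonoidHom

namespace FusionSystem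

variable {P : Type*} [Group P]

theorem symm_mem (F : FusionSystem P) {Q R : Subgroup P} {e : Q ≃* R}
    (he : e.toMonoidHom ∈ F.Hom Q R) : e.symm.toMonoidHom ∈ F.Hom R Q := by
  obtain ⟨S, hS, e', -, h2, h3⟩ := F.factor he
  have key : ∀ u : Q, (e u : P) = e' u := fun u => by
    have := congrArg (fun f : Q →* R => ((f u : R) : P)) h3
    simpa using this
  have hRS : R = S := by
    apply le_antisymm _ hS
    intro v hv
    have := key (e.symm ⟨v, hv⟩)
    rw [MulEquiv.apply_symm_apply] at this
    change v = _ at this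
    rw [this]
    exact SetLike.coe_mem _
  subst hRS
  have : e = e' := by
    ext u
    exact key u
  rw [this]
  exact h2

/-- `Aut_F(Q)`, the group of automorphisms of `Q` in the category `F`. -/
def aut (F : FusionSystem P) (Q : Subgroup P) : Subgroup (MulAut Q) where
  carrier := {e | MulEquiv.toMonoidHom e ∈ F.Hom Q Q}
  one_mem' := F.conj_mem _ 1 (by intro u; simp)
  mul_mem' := fun {a b} ha hb => by
    have h := F.comp_mem (φ := MulEquiv.toMonoidHom b) (ψ := MulEquiv.toMonoidHom a) hb ha
    exact h
  inv_mem' := fun {a} ha => F.symm_mem (e := a) ha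

/-- `Aut_P(Q)`, the group of automorphisms of `Q` induced by conjugation with elements of the
normalizer of `Q` in `P`. -/
def autInner (Q : Subgroup P) : Subgroup (MulAut Q) :=
  Q.normalizerMonoidHom.range

/-- `Q` and `R` are isomorphic in the category `F`. -/
def IsConj (F : FusionSystem P) (Q R : Subgroup P) : Prop :=
  ∃ e : Q ≃* R, e.toMonoidHom ∈ F.Hom Q R

/-- `Q` is fully `F`-normalized: `|N_P(R)| ≤ |N_P(Q)|` for all `R` that are `F`-isomorphic
to `Q`. -/
def IsFullyNormalized (F : FusionSystem P) (Q : Subgroup P) : Prop :=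
  ∀ R : Subgroup P, F.IsConj Q R →
    Nat.card (Subgroup.normalizer (R : Set P)) ≤ Nat.card (Subgroup.normalizer (Q : Set P))

/-- `Q` is fully `F`-centralized: `|C_P(R)| ≤ |C_P(Q)|` for all `R` that are `F`-isomorphic
to `Q`. -/
def IsFullyCentralized (F : FusionSystem P) (Q : Subgroup P) : Prop :=
  ∀ R : Subgroup P, F.IsConj Q R →
    Nat.card (Subgroup.centralizer (R : Set P)) ≤ Nat.card (Subgroup.centralizer (Q : Set P))

/-- For an isomorphism `e : Q → S` of subgroups of `P`, the subgroup
`N_e = {g ∈ N_P(Q) ∣ e ∘ c_g ∘ e⁻¹ ∈ Aut_P(S)}` of `P`, where `c_g` is conjugation by `g`. -/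
def extender {Q S : Subgroup P} (e : Q ≃* S) : Subgroup P :=
  ((autInner S).comap
    ((MulAut.congr e).toMonoidHom.comp Q.normalizerMonoidHom)).map
      (Subgroup.normalizer (Q : Set P)).subtype

theorem le_extender {Q S : Subgroup P} (e : Q ≃* S) : Q ≤ extender e := by
  intro u hu
  refine ⟨⟨u, Subgroup.le_normalizer hu⟩, ?_, rfl⟩
  refine ⟨⟨e ⟨u, hu⟩, Subgroup.le_normalizer (SetLike.coe_mem _)⟩, ?_⟩
  ext v
  have h : (Q.normalizerMonoidHom ⟨u, Subgroup.le_normalizer hu⟩) (e.symm v)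
      = ⟨u, hu⟩ * e.symm v * ⟨u, hu⟩⁻¹ := by
    ext; rfl
  change (e ⟨u, hu⟩ : P) * v * (e ⟨u, hu⟩ : P)⁻¹ =
    ((e ((Q.normalizerMonoidHom ⟨u, Subgroup.le_normalizer hu⟩) (e.symm v)) : S) : P)
  rw [h]
  simp

/-- `F` is a saturated fusion system at the prime `p` (for a finite `p`-group `P`). -/
structure IsSaturated (p : ℕ) (F : FusionSystem P) : Prop where
  fullyCentralized : ∀ Q : Subgroup P, F.IsFullyNormalized Q → F.IsFullyCentralized Q
  sylow : ∀ Q : Subgroup P, F.IsFullyNormalized Q →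
    ∃ T : Sylow p (F.aut Q), (T : Subgroup (F.aut Q)) = (autInner Q).subgroupOf (F.aut Q)
  extension : ∀ (Q S : Subgroup P) (e : Q ≃* S), e.toMonoidHom ∈ F.Hom Q S →
    F.IsFullyCentralized S →
      ∃ ψ ∈ F.Hom (extender e) ⊤,
        ∀ u : Q, (ψ (Subgroup.inclusion (le_extender e) u) : P) = e u

/-- The fusion system `F_P(P)`, whose morphisms are exactly the homomorphisms induced by
conjugation with elements of `P`. -/
def inner (P : Type*) [Group P] : FusionSystem P where
  Hom Q R := {φ | ∃ g : P, ∀ u : Q, (φ u : P) = g * u * g⁻¹}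
  injective := by
    rintro Q R φ ⟨g, hg⟩ u v huv
    have h : g * (u : P) * g⁻¹ = g * (v : P) * g⁻¹ := by rw [← hg, ← hg, huv]
    exact Subtype.ext (by simpa using h)
  conj_mem φ g h := ⟨g, h⟩
  comp_mem := by
    rintro Q R S φ ψ ⟨g, hg⟩ ⟨h, hh⟩
    refine ⟨h * g, fun u => ?_⟩
    simp [hh, hg, mul_assoc]
  factor := by
    rintro Q R φ ⟨g, hg⟩
    refine ⟨Q.map (MulAut.conj g).toMonoidHom, ?_,
      Q.equivMapOfInjective _ (MulAut.conj g).injective, ⟨g, ?_⟩, ⟨g⁻¹, ?_⟩, ?_⟩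
    · rintro _ ⟨u, hu, rfl⟩
      have := hg ⟨u, hu⟩
      change g * u * g⁻¹ ∈ R
      rw [← this]
      exact SetLike.coe_mem _
    · intro u
      rfl
    · intro v
      obtain ⟨u, rfl⟩ :=
        (Q.equivMapOfInjective _ (MulAut.conj g).injective).surjective v
      have h : ∀ e : Q ≃* Q.map (MulAut.conj g).toMonoidHom,
          e.symm.toMonoidHom (e u) = u := fun e => e.symm_apply_apply u
      rw [h]
      change (u : P) = g⁻¹ * (g * u * g⁻¹) * g⁻¹⁻¹
      simp [mul_assoc]
    · ext u
      exact hg u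

/-- `F` is nilpotent: `F = F_P(P)`. -/
def IsNilpotent (F : FusionSystem P) : Prop :=
  F = inner P

/-- `F` is controlled by `P`, i.e. `F = N_F(P)`: every morphism of `F` is the restriction of some
automorphism of `P` in `F`. -/
def IsControlled (F : FusionSystem P) : Prop :=
  ∀ (Q R : Subgroup P), ∀ φ ∈ F.Hom Q R,
    ∃ α ∈ F.aut ⊤, ∀ u : Q, (α (Subgroup.inclusion le_top u) : P) = φ u

end FusionSystem

/-!
Let `r ≥ s ≥ 2`. Everything rests on two properties of `D`: all its involutions are central, and
each of its subgroups `Q` is abelian or satisfies `D = Q Z(D)`. For the first, an element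
`x ^ a * y ^ b * z ^ k`, where `z = [x, y]`, whose square is trivial has trivial square in
`C_{2^r} × C_{2^s}`, so `a` and `b` are even, and `x ^ 2`, `y ^ 2` and `z` are central. The second
holds because `D / Z(D)` is a quotient of the four-group.

These properties imply that every saturated fusion system `F` on `D` is controlled
(`FusionSystem.IsSaturated.isControlled`). By downward induction on `|Q|` it suffices that each
isomorphism `e : Q → T` of `F` with `T` fully normalized extends to `N_D(Q)`, i.e. that conjugation
by `g ∈ N_D(Q)` is carried by `e` into `Aut_D(T)`
(`FusionSystem.IsSaturated.normalizer_le_extender`). If `D = Q Z(D)`, then `g` acts on `Q` like an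
element `q` of `Q`, and conjugation by `e q` is the required automorphism of `T`. If `Q` and `T` are
abelian, note that an automorphism of odd order of an abelian `2`-group is trivial once it fixes all
involutions. Hence the elements of `Aut_F(T)` that fix all involutions of `T` form a `2`-group. It
contains the Sylow subgroup `Aut_D(T)`, since involutions are central, and so it equals
`Aut_D(T)`. It also contains the automorphism of `T` obtained from `g`, for the same reason.

If moreover `r > s`, then `Aut(D)` is a `2`-group (`RedeiCoordinates.isPGroup_mulAut`): an
automorphism `α` of odd order fixes in turn `x ^ 2 ^ (r - 1)`, `z`, all involutions, the centre, `y`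
and `x`. At most stages `α` preserves a coset of elements that are already known to be fixed, so
`α t = t * u` with `u` fixed, which forces `u = 1` as the order of `α` is odd
(`MulAut.eq_one_of_apply_eq_mul`). Therefore `Aut_F(D)` equals its Sylow subgroup `Inn(D)`, and a
controlled fusion system with this property is nilpotent.
-/

open scoped commutatorElement

/-! ### Automorphisms of odd order -/

/-- If `α` has odd order and multiplies `t` by a fixed element `u` of `2`-power order, then
`t = (α ^ m) t = t * u ^ m` forces `u = 1`. -/
theorem MulAut.eq_one_of_apply_eq_mul {G : Type*} [Group G] {α : MulAut G} {m : ℕ} (hm : Odd m)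
    (hα : α ^ m = 1) {t u : G} (hu : α u = u) (h : α t = t * u) {k : ℕ} (huk : u ^ 2 ^ k = 1) :
    u = 1 := by
  have key : ∀ n : ℕ, (α ^ n) t = t * u ^ n := by
    intro n
    induction n with
    | zero => simp
    | succ n ih => rw [pow_succ', MulAut.mul_apply, ih, map_mul, map_pow, hu, h, mul_assoc,
        pow_succ']
  have hum : u ^ m = 1 := by
    have := key m
    rw [hα, MulAut.one_apply] at this
    exact (left_eq_mul.mp this)
  have hco : Nat.Coprime m (2 ^ k) := (Nat.Coprime.pow_right k hm.coprime_two_right)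
  simpa [hco.gcd_eq_one] using pow_gcd_eq_one.mpr ⟨hum, huk⟩

/-- An automorphism of odd order that fixes all involutions fixes every element `t` of `2`-power
order which commutes with its image: by induction `t ^ 2` is fixed, so that `t⁻¹ * α t` is an
involution and hence fixed. -/
theorem MulAut.apply_eq_of_commute {G : Type*} [Group G] {α : MulAut G} {m : ℕ} (hm : Odd m)
    (hα : α ^ m = 1) (hinv : ∀ u : G, u ^ 2 = 1 → α u = u) {k : ℕ} :
    ∀ {t : G}, Commute t (α t) → t ^ 2 ^ k = 1 → α t = t := by
  induction k with
  | zero => intro t _ ht; simp at ht; simp [ht]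
  | succ k ih =>
    intro t hc ht
    have h2 : α (t ^ 2) = t ^ 2 := by
      apply ih
      · rw [map_pow]; exact hc.pow_pow 2 2
      · rw [← pow_mul, ← pow_succ', ht]
    have hu2 : (t⁻¹ * α t) ^ 2 = 1 := by
      rw [hc.inv_left.mul_pow, ← map_pow, h2, inv_pow, inv_mul_cancel]
    have h1 := MulAut.eq_one_of_apply_eq_mul (k := 1) hm hα (hinv _ hu2)
      (mul_inv_cancel_left t (α t)).symm (by simpa using hu2)
    exact (inv_mul_eq_one.mp h1).symm

theorem IsPGroup.of_odd_pow_eq_one {G : Type*} [Group G] [Finite G]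
    (h : ∀ (g : G) (m : ℕ), Odd m → g ^ m = 1 → g = 1) : IsPGroup 2 G := by
  intro g
  obtain ⟨k, m, hm, hk⟩ := Nat.exists_eq_two_pow_mul_odd (orderOf_pos g).ne'
  refine ⟨k, h _ m hm ?_⟩
  rw [← pow_mul, ← hk, pow_orderOf_eq_one]

/-! ### A criterion for a saturated fusion system to be controlled -/

namespace FusionSystem

variable {P : Type*} [Group P] {F : FusionSystem P}

/-- To show `g ∈ N_e` it suffices to give `k` whose conjugation action on `S` corresponds under `e`
to that of `g` on `Q`. The action of `g` is described by pairs `u`, `v` with `v = g * u * g⁻¹`. -/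
theorem mem_extender {Q S : Subgroup P} (e : Q ≃* S) {g k : P}
    (hg : g ∈ Subgroup.normalizer (Q : Set P)) (hk : k ∈ Subgroup.normalizer (S : Set P))
    (h : ∀ u v : Q, (v : P) = g * u * g⁻¹ → (e v : P) = k * e u * k⁻¹) : g ∈ extender e := by
  refine ⟨⟨g, hg⟩, ⟨⟨k, hk⟩, ?_⟩, rfl⟩
  ext w
  have := h (e.symm w) (Q.normalizerMonoidHom ⟨g, hg⟩ (e.symm w)) rfl
  rw [MulEquiv.apply_symm_apply] at this
  exact this.symm

theorem IsConj.refl (F : FusionSystem P) (Q : Subgroup P) : F.IsConj Q Q :=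
  ⟨MulEquiv.refl Q, F.conj_mem _ 1 (by intro u; simp)⟩

theorem trans_mem {Q R S : Subgroup P} {e : Q ≃* R} {f : R ≃* S}
    (he : e.toMonoidHom ∈ F.Hom Q R) (hf : f.toMonoidHom ∈ F.Hom R S) :
    (e.trans f).toMonoidHom ∈ F.Hom Q S :=
  F.comp_mem he hf

theorem exists_isFullyNormalized [Finite P] (F : FusionSystem P) (Q : Subgroup P) :
    ∃ T, F.IsConj Q T ∧ F.IsFullyNormalized T := by
  obtain ⟨T, ⟨e, he⟩, hT⟩ := Set.exists_max_image {T | F.IsConj Q T}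
    (fun T => Nat.card (Subgroup.normalizer (T : Set P))) (Set.toFinite _)
    ⟨Q, IsConj.refl F Q⟩
  exact ⟨T, ⟨e, he⟩, fun R ⟨f, hf⟩ => hT R ⟨e.trans f, trans_mem he hf⟩⟩

/-- If all involutions of `P` are central, then every element of `Aut_P(T)` fixes all involutions
of `T`. For `T` abelian, the elements of `Aut_F(T)` with this property form a `2`-group, so if `T`
is fully normalized they all belong to the Sylow subgroup `Aut_P(T)`. -/
theorem IsSaturated.mem_autInner_of_fixes_involutions [Finite P] (hF : F.IsSaturated 2)
    (hP : IsPGroup 2 P) (hinv : ∀ t : P, t ^ 2 = 1 → t ∈ Subgroup.center P) {T : Subgroup P}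
    (hT : F.IsFullyNormalized T) (hcomm : ∀ a ∈ T, ∀ b ∈ T, a * b = b * a) {a : MulAut T}
    (ha : a ∈ F.aut T) (hfix : ∀ u : T, u ^ 2 = 1 → a u = u) : a ∈ autInner T := by
  let K : Subgroup (F.aut T) :=
    { carrier := {a | ∀ u : T, u ^ 2 = 1 → a.1 u = u}
      one_mem' := fun u _ => rfl
      mul_mem' := fun {a b} ha hb u hu => by
        change a.1 (b.1 u) = u
        rw [hb u hu, ha u hu]
      inv_mem' := fun {a} ha u hu => by
        change a.1.symm u = u
        rw [MulEquiv.symm_apply_eq, ha u hu] }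
  have hK : IsPGroup 2 K := by
    apply IsPGroup.of_odd_pow_eq_one
    intro g m hm hg
    have hg' : (g : F.aut T).1 ^ m = 1 := by
      have := congrArg (fun g : K => (g : F.aut T).1) hg
      simpa using this
    ext u
    obtain ⟨k, hk⟩ := hP u
    have := MulAut.apply_eq_of_commute (t := u) (k := k) hm hg' g.2
      (Subtype.ext (hcomm _ u.2 _ (SetLike.coe_mem _))) (Subtype.ext (by simpa using hk))
    exact congrArg Subtype.val this
  obtain ⟨S, hS⟩ := hF.sylow T hT
  have hSK : (S : Subgroup (F.aut T)) ≤ K := by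
    rw [hS]
    rintro a ha u hu
    obtain ⟨g, hg⟩ := Subgroup.mem_subgroupOf.mp ha
    rw [← hg]
    apply Subtype.ext
    change (g : P) * u * (g : P)⁻¹ = u
    rw [Subgroup.mem_center_iff.mp (hinv u (by simpa using congrArg Subtype.val hu)),
      mul_inv_cancel_right]
  have haK : (⟨a, ha⟩ : F.aut T) ∈ K := hfix
  rw [S.is_maximal' hK hSK, hS] at haK
  exact haK

/-- The hypotheses on `P` make every isomorphism onto a fully normalized subgroup `T` extend to the
normalizer of its source. If `T` is not abelian, then neither is `Q`, so that `P = Q Z(P)`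
acts on `Q` by inner automorphisms of `Q`; if `T` is abelian, the conjugates under `e` of the
automorphisms in `Aut_P(Q)` fix the involutions of `T`. -/
theorem IsSaturated.normalizer_le_extender [Finite P] (hF : F.IsSaturated 2)
    (hP : IsPGroup 2 P) (hinv : ∀ t : P, t ^ 2 = 1 → t ∈ Subgroup.center P)
    (hsub : ∀ Q : Subgroup P, (∀ a ∈ Q, ∀ b ∈ Q, a * b = b * a) ∨
      ∀ g : P, ∃ q ∈ Q, q⁻¹ * g ∈ Subgroup.center P)
    {Q T : Subgroup P} {e : Q ≃* T} (he : e.toMonoidHom ∈ F.Hom Q T)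
    (hT : F.IsFullyNormalized T) : Subgroup.normalizer (Q : Set P) ≤ extender e := by
  intro g hg
  rcases hsub Q with hQ | hQ
  · have hcomm : ∀ a ∈ T, ∀ b ∈ T, a * b = b * a := by
      intro a ha b hb
      have h := hQ (e.symm ⟨a, ha⟩) (SetLike.coe_mem _) (e.symm ⟨b, hb⟩) (SetLike.coe_mem _)
      have h' : e.symm ⟨a, ha⟩ * e.symm ⟨b, hb⟩ = e.symm ⟨b, hb⟩ * e.symm ⟨a, ha⟩ := Subtype.ext h
      rw [← map_mul, ← map_mul] at h'
      exact congrArg Subtype.val (e.symm.injective h')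
    have hc : Q.normalizerMonoidHom ⟨g, hg⟩ ∈ F.aut Q := F.conj_mem _ g fun u => rfl
    have ha : (MulAut.congr e) (Q.normalizerMonoidHom ⟨g, hg⟩) ∈ F.aut T :=
      F.comp_mem (F.symm_mem he) (F.comp_mem hc he)
    refine ⟨⟨g, hg⟩, hF.mem_autInner_of_fixes_involutions hP hinv hT hcomm ha ?_, rfl⟩
    intro u hu
    change e (Q.normalizerMonoidHom ⟨g, hg⟩ (e.symm u)) = u
    have : Q.normalizerMonoidHom ⟨g, hg⟩ (e.symm u) = e.symm u := by
      apply Subtype.ext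
      change g * (e.symm u : P) * g⁻¹ = e.symm u
      have h2 : (e.symm u) ^ 2 = 1 := by rw [← map_pow, hu, map_one]
      have hz : (e.symm u : P) ∈ Subgroup.center P :=
        hinv _ (by simpa using congrArg Subtype.val h2)
      rw [Subgroup.mem_center_iff.mp hz, mul_inv_cancel_right]
    rw [this, MulEquiv.apply_symm_apply]
  · obtain ⟨q, hq, hz⟩ := hQ g
    refine mem_extender e hg (Subgroup.le_normalizer (e ⟨q, hq⟩).2) ?_
    intro u v huv
    have : v = ⟨q, hq⟩ * u * ⟨q, hq⟩⁻¹ := by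
      apply Subtype.ext
      have hzu := Subgroup.mem_center_iff.mp hz u
      have hg' : g = q * (q⁻¹ * g) := by group
      rw [huv, hg']
      generalize q⁻¹ * g = c at hzu
      simp only [Subgroup.coe_mul, Subgroup.coe_inv, mul_inv_rev]
      rw [mul_assoc q c, ← hzu]
      group
    rw [this]
    simp

theorem isFullyNormalized_top [Finite P] (F : FusionSystem P) : F.IsFullyNormalized ⊤ := by
  intro R _
  refine Subgroup.card_le_of_le ?_
  rw [top_le_iff.mp (Subgroup.le_normalizer (H := (⊤ : Subgroup P)))]
  exact le_top

/-- Downward induction on `|Q|`: an isomorphism `Q → S` is a quotient of two isomorphisms onto a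
fully normalized subgroup, and those extend to the strictly larger normalizers. -/
theorem IsSaturated.isControlled [Finite P] (hF : F.IsSaturated 2)
    (hP : IsPGroup 2 P) (hinv : ∀ t : P, t ^ 2 = 1 → t ∈ Subgroup.center P)
    (hsub : ∀ Q : Subgroup P, (∀ a ∈ Q, ∀ b ∈ Q, a * b = b * a) ∨
      ∀ g : P, ∃ q ∈ Q, q⁻¹ * g ∈ Subgroup.center P) : F.IsControlled := by
  have main : ∀ (n : ℕ) (Q S : Subgroup P) (e : Q ≃* S), Nat.card P - Nat.card Q = n →
      e.toMonoidHom ∈ F.Hom Q S →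
      ∃ α ∈ F.aut ⊤, ∀ u : Q, (α (Subgroup.inclusion le_top u) : P) = e u := by
    intro n
    induction n using Nat.strong_induction_on with
    | _ n ih =>
    intro Q S e hn he
    have ext_of : ∀ (Q' T : Subgroup P) (f : Q' ≃* T), Nat.card Q' = Nat.card Q →
        f.toMonoidHom ∈ F.Hom Q' T → F.IsFullyNormalized T →
        ∃ α ∈ F.aut ⊤, ∀ u : Q', (α (Subgroup.inclusion le_top u) : P) = f u := by
      intro Q' T f hcard hf hT
      by_cases hQ' : Q' = ⊤
      · subst hQ'
        have : T = ⊤ := by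
          apply Subgroup.eq_top_of_card_eq
          rw [← Nat.card_congr f.toEquiv, Subgroup.card_top]
        subst this
        exact ⟨f, hf, fun u => rfl⟩
      · have hlt : Q' < Subgroup.normalizer (Q' : Set P) := by
          have := Fact.mk Nat.prime_two
          have := hP.isNilpotent
          exact Group.normalizerCondition_of_isNilpotent Q' (lt_top_iff_ne_top.mpr hQ')
        have hle := hF.normalizer_le_extender hP hinv hsub hf hT
        obtain ⟨ψ, hψ, hψf⟩ := hF.extension Q' T f hf (hF.fullyCentralized T hT)
        obtain ⟨S', hS', g, hg, -, hgψ⟩ := F.factor hψ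
        have hcardlt : Nat.card Q' < Nat.card (extender f) := by
          refine lt_of_lt_of_le ?_ (Subgroup.card_le_of_le hle)
          exact Set.ncard_lt_ncard hlt (Set.toFinite _)
        have hleP : Nat.card (extender f) ≤ Nat.card P := Subgroup.card_le_card_group _
        obtain ⟨α, hα, hαg⟩ := ih (Nat.card P - Nat.card (extender f)) (by omega) _ _ g rfl hg
        refine ⟨α, hα, fun u => ?_⟩
        rw [← hψf, hgψ]
        exact hαg (Subgroup.inclusion (le_extender f) u)
    obtain ⟨T, ⟨f, hf⟩, hT⟩ := F.exists_isFullyNormalized S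
    obtain ⟨α, hα, hα'⟩ := ext_of Q T (e.trans f) rfl (trans_mem he hf) hT
    obtain ⟨β, hβ, hβ'⟩ := ext_of S T f (Nat.card_congr e.toEquiv).symm hf hT
    refine ⟨β⁻¹ * α, mul_mem (inv_mem hβ) hα, fun u => ?_⟩
    have : α (Subgroup.inclusion le_top u) = β (Subgroup.inclusion le_top (e u)) :=
      Subtype.ext (by rw [hα', hβ']; rfl)
    rw [MulAut.mul_apply, this, MulAut.inv_apply_self]
    rfl
  intro Q R φ hφ
  obtain ⟨S, hS, e, he, -, rfl⟩ := F.factor hφ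
  obtain ⟨α, hα, h⟩ := main _ Q S e rfl he
  exact ⟨α, hα, h⟩

/-- If `Aut_F(P)` is a `2`-group, it coincides with its Sylow subgroup `Inn(P)`, so a controlled
fusion system has only the morphisms induced by `P`. -/
theorem IsSaturated.isNilpotent_of_isControlled [Finite P] (hF : F.IsSaturated 2)
    (hc : F.IsControlled) (hA : IsPGroup 2 (MulAut (⊤ : Subgroup P))) : F.IsNilpotent := by
  obtain ⟨S, hS⟩ := hF.sylow ⊤ F.isFullyNormalized_top
  have htop : (⊤ : Subgroup (F.aut ⊤)) = S :=
    S.is_maximal' ((hA.to_subgroup (F.aut ⊤)).to_subgroup ⊤) le_top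
  apply FusionSystem.ext
  funext Q R
  ext φ
  constructor
  · intro hφ
    obtain ⟨α, hα, h⟩ := hc Q R φ hφ
    have hmem : (⟨α, hα⟩ : F.aut ⊤) ∈ (S : Subgroup (F.aut ⊤)) := htop ▸ Subgroup.mem_top _
    rw [hS] at hmem
    obtain ⟨g, hg⟩ := Subgroup.mem_subgroupOf.mp hmem
    refine ⟨g, fun u => ?_⟩
    rw [← h u]
    change _ = _ at hg
    rw [show α = _ from hg.symm]
    rfl
  · rintro ⟨g, hg⟩
    exact F.conj_mem φ g hg

end FusionSystem

/-! ### The minimal nonabelian group in coordinates -/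

/-- Generators `x`, `y` of a group, with central commutator `z`, satisfying the relations of
`RedeiGroup r s`, together with the two coordinate characters `A` and `B` of the abelianization,
which show that it is no smaller than `C_{2^r} × C_{2^s}`. It is not required that `z ≠ 1`: the
arguments do not distinguish this group from its abelianization. -/
structure RedeiCoordinates (D : Type*) [Group D] (r s : ℕ) where
  x : D
  y : D
  z : D
  A : D →* Multiplicative (ZMod (2 ^ r))
  B : D →* Multiplicative (ZMod (2 ^ s))
  x_pow : x ^ 2 ^ r = 1
  y_pow : y ^ 2 ^ s = 1
  z_sq : z ^ 2 = 1
  commutator : ⁅x, y⁆ = z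
  comm_xz : Commute x z
  comm_yz : Commute y z
  A_x : A x = Multiplicative.ofAdd 1
  A_y : A y = 1
  B_x : B x = 1
  B_y : B y = Multiplicative.ofAdd 1
  closure_eq_top : Subgroup.closure {x, y} = ⊤

theorem RedeiGroup.nonempty_coordinates (r s : ℕ) :
    Nonempty (RedeiCoordinates (RedeiGroup r s) r s) := by
  let x : FreeGroup (Fin 2) := FreeGroup.of 0
  let y : FreeGroup (Fin 2) := FreeGroup.of 1
  let rels : Set (FreeGroup (Fin 2)) :=
    {x ^ 2 ^ r, y ^ 2 ^ s, ⁅x, y⁆ ^ 2, ⁅x, ⁅x, y⁆⁆, ⁅y, ⁅x, y⁆⁆}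
  let π : FreeGroup (Fin 2) →* PresentedGroup rels := PresentedGroup.mk rels
  have one : ∀ w ∈ rels, π w = 1 := fun w hw => PresentedGroup.one_of_mem hw
  have comm : ∀ {n : ℕ} (f : FreeGroup (Fin 2) →* Multiplicative (ZMod n))
      (u v : FreeGroup (Fin 2)), f ⁅u, v⁆ = 1 := by
    intro n f u v
    rw [map_commutatorElement, commutatorElement_eq_one_iff_commute]
    exact Commute.all _ _
  have hA : ∀ w ∈ rels, FreeGroup.lift (![Multiplicative.ofAdd (1 : ZMod (2 ^ r)), 1]) w = 1 := by
    rintro w (rfl | rfl | rfl | rfl | rfl)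
    · simp [x, ← ofAdd_nsmul]
    · simp [y]
    · rw [map_pow, comm, one_pow]
    · exact comm _ _ _
    · exact comm _ _ _
  have hB : ∀ w ∈ rels, FreeGroup.lift (![1, Multiplicative.ofAdd (1 : ZMod (2 ^ s))]) w = 1 := by
    rintro w (rfl | rfl | rfl | rfl | rfl)
    · simp [x]
    · simp [y, ← ofAdd_nsmul]
    · rw [map_pow, comm, one_pow]
    · exact comm _ _ _
    · exact comm _ _ _
  exact ⟨
    { x := π x
      y := π y
      z := π ⁅x, y⁆
      A := PresentedGroup.toGroup hA
      B := PresentedGroup.toGroup hB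
      x_pow := by rw [← map_pow]; exact one _ (by simp [rels])
      y_pow := by rw [← map_pow]; exact one _ (by simp [rels])
      z_sq := by rw [← map_pow]; exact one _ (by simp [rels])
      commutator := (map_commutatorElement π x y).symm
      comm_xz := by
        rw [← commutatorElement_eq_one_iff_commute, ← map_commutatorElement]
        exact one _ (by simp [rels])
      comm_yz := by
        rw [← commutatorElement_eq_one_iff_commute, ← map_commutatorElement]
        exact one _ (by simp [rels])
      A_x := PresentedGroup.toGroup.of hA
      A_y := PresentedGroup.toGroup.of hA
      B_x := PresentedGroup.toGroup.of hB
      B_y := PresentedGroup.toGroup.of hB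
      closure_eq_top := by
        rw [← PresentedGroup.closure_range_of]
        congr 1
        ext g
        constructor
        · rintro (rfl | rfl)
          · exact ⟨0, rfl⟩
          · exact ⟨1, rfl⟩
        · rintro ⟨i, rfl⟩
          fin_cases i
          · exact Or.inl rfl
          · exact Or.inr rfl }⟩

namespace RedeiCoordinates

variable {D : Type*} [Group D] {r s : ℕ}

/-- Transport of coordinates along an isomorphism. -/
def ofMulEquiv {G : Type*} [Group G] (c : RedeiCoordinates G r s) (e : D ≃* G) :
    RedeiCoordinates D r s where
  x := e.symm c.x
  y := e.symm c.y
  z := e.symm c.z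
  A := c.A.comp e.toMonoidHom
  B := c.B.comp e.toMonoidHom
  x_pow := by rw [← map_pow, c.x_pow, map_one]
  y_pow := by rw [← map_pow, c.y_pow, map_one]
  z_sq := by rw [← map_pow, c.z_sq, map_one]
  commutator := by rw [← map_commutatorElement, c.commutator]
  comm_xz := c.comm_xz.map e.symm
  comm_yz := c.comm_yz.map e.symm
  A_x := by simp [c.A_x]
  A_y := by simp [c.A_y]
  B_x := by simp [c.B_x]
  B_y := by simp [c.B_y]
  closure_eq_top := by
    have := congrArg (Subgroup.map e.symm.toMonoidHom) c.closure_eq_top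
    rw [MonoidHom.map_closure, Set.image_pair, Subgroup.map_top_of_surjective _ e.symm.surjective]
      at this
    exact this

variable (c : RedeiCoordinates D r s)

theorem mem_center {g : D} (hx : Commute c.x g) (hy : Commute c.y g) : g ∈ Subgroup.center D := by
  have h : Subgroup.closure {c.x, c.y} ≤ Subgroup.centralizer {g} := by
    rw [Subgroup.closure_le]
    rintro _ (rfl | rfl)
    · exact Subgroup.mem_centralizer_singleton_iff.mpr hx
    · exact Subgroup.mem_centralizer_singleton_iff.mpr hy
  rw [c.closure_eq_top] at h
  exact Subgroup.mem_center_iff.mpr fun w =>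
    Subgroup.mem_centralizer_singleton_iff.mp (h (Subgroup.mem_top w))

theorem z_mem_center : c.z ∈ Subgroup.center D := c.mem_center c.comm_xz c.comm_yz

theorem commute_z (g : D) : Commute g c.z := Subgroup.mem_center_iff.mp c.z_mem_center g

theorem y_mul_x_zpow (a : ℤ) : c.y * c.x ^ a = c.z ^ (-a) * c.x ^ a * c.y := by
  have h : c.y * c.x * c.y⁻¹ = c.z⁻¹ * c.x := by
    rw [← c.commutator, commutatorElement_def]; group
  have := congrArg (· ^ a) h
  simp only [conj_zpow] at this
  rw [(c.commute_z c.x).symm.inv_left.mul_zpow, inv_zpow', mul_inv_eq_iff_eq_mul] at this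
  exact this

theorem y_zpow_mul_x_zpow (a b : ℤ) :
    c.y ^ b * c.x ^ a = c.z ^ (-(a * b)) * c.x ^ a * c.y ^ b := by
  have h : c.x ^ (-a) * c.y * c.x ^ a = c.z ^ (-a) * c.y := by
    rw [mul_assoc, c.y_mul_x_zpow, ← mul_assoc, ← mul_assoc,
      ((c.commute_z (c.x ^ (-a))).zpow_right (-a)).eq, mul_assoc (c.z ^ (-a)), ← zpow_add,
      neg_add_cancel, zpow_zero, mul_one]
  have h' : c.x ^ (-a) * c.y ^ b * c.x ^ a = (c.z ^ (-a) * c.y) ^ b := by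
    rw [← h]
    have := (conj_zpow (i := b) (a := c.x ^ (-a)) (b := c.y)).symm
    rwa [zpow_neg, inv_inv, ← zpow_neg] at this
  rw [((c.commute_z c.y).zpow_right (-a)).symm.mul_zpow, ← zpow_mul, mul_assoc, zpow_neg,
    inv_mul_eq_iff_eq_mul, ← mul_assoc, ((c.commute_z (c.x ^ a)).zpow_right _).eq] at h'
  rw [h', neg_mul]

/-- Every element has the normal form `x ^ a * y ^ b * z ^ k`. -/
theorem exists_eq (t : D) : ∃ a b k : ℤ, t = c.x ^ a * c.y ^ b * c.z ^ k := by
  have hx : ∀ (i : ℤ) (w : D), (∃ a b k : ℤ, w = c.x ^ a * c.y ^ b * c.z ^ k) →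
      ∃ a b k : ℤ, c.x ^ i * w = c.x ^ a * c.y ^ b * c.z ^ k := by
    rintro i _ ⟨a, b, k, rfl⟩
    exact ⟨i + a, b, k, by rw [zpow_add]; group⟩
  have hy : ∀ (i : ℤ) (w : D), (∃ a b k : ℤ, w = c.x ^ a * c.y ^ b * c.z ^ k) →
      ∃ a b k : ℤ, c.y ^ i * w = c.x ^ a * c.y ^ b * c.z ^ k := by
    rintro i _ ⟨a, b, k, rfl⟩
    refine ⟨a, i + b, k - a * i, ?_⟩
    rw [← mul_assoc, ← mul_assoc, c.y_zpow_mul_x_zpow, mul_assoc (c.z ^ _), mul_assoc (c.z ^ _),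
      mul_assoc (c.z ^ _), ← ((c.commute_z _).zpow_right _).eq, zpow_add,
      show k - a * i = k + -(a * i) by ring, zpow_add]
    group
  have ht : t ∈ Subgroup.closure {c.x, c.y} := c.closure_eq_top ▸ Subgroup.mem_top t
  induction ht using Subgroup.closure_induction_left with
  | one => exact ⟨0, 0, 0, by simp⟩
  | mul_left g hg w _ ih =>
    rcases hg with rfl | rfl
    · simpa using hx 1 w ih
    · simpa using hy 1 w ih
  | inv_mul_cancel g hg w _ ih =>
    rcases hg with rfl | rfl
    · simpa using hx (-1) w ih
    · simpa using hy (-1) w ih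

theorem A_apply (a b k : ℤ) :
    c.A (c.x ^ a * c.y ^ b * c.z ^ k) = Multiplicative.ofAdd (a : ZMod (2 ^ r)) := by
  have hz : c.A c.z = 1 := by
    rw [← c.commutator, map_commutatorElement, commutatorElement_eq_one_iff_commute]
    exact Commute.all _ _
  simp only [map_mul, map_zpow, c.A_x, c.A_y, hz, one_zpow, mul_one, ← ofAdd_zsmul,
    zsmul_eq_mul]

theorem B_apply (a b k : ℤ) :
    c.B (c.x ^ a * c.y ^ b * c.z ^ k) = Multiplicative.ofAdd (b : ZMod (2 ^ s)) := by
  have hz : c.B c.z = 1 := by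
    rw [← c.commutator, map_commutatorElement, commutatorElement_eq_one_iff_commute]
    exact Commute.all _ _
  simp only [map_mul, map_zpow, c.B_x, c.B_y, hz, one_zpow, mul_one, one_mul, ← ofAdd_zsmul,
    zsmul_eq_mul]

theorem mem_zpowers_z {t : D} (hA : c.A t = 1) (hB : c.B t = 1) : t ∈ Subgroup.zpowers c.z := by
  obtain ⟨a, b, k, rfl⟩ := c.exists_eq t
  rw [c.A_apply, ofAdd_eq_one, ZMod.intCast_zmod_eq_zero_iff_dvd] at hA
  rw [c.B_apply, ofAdd_eq_one, ZMod.intCast_zmod_eq_zero_iff_dvd] at hB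
  obtain ⟨a, rfl⟩ := hA
  obtain ⟨b, rfl⟩ := hB
  refine ⟨k, ?_⟩
  have hx := c.x_pow
  have hy := c.y_pow
  rw [← zpow_natCast] at hx hy
  simp only [zpow_mul, hx, hy, one_zpow, one_mul]

/-- If the exponents of `x` and `y` are even, the element is central, since
`[x ^ 2, y] = [x, y ^ 2] = z ^ 2 = 1`. -/
theorem mem_center_of_even {a b : ℤ} (ha : Even a) (hb : Even b) (k : ℤ) :
    c.x ^ a * c.y ^ b * c.z ^ k ∈ Subgroup.center D := by
  have hz : ∀ i : ℤ, Even i → c.z ^ i = 1 := by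
    rintro i ⟨j, rfl⟩
    have := c.z_sq
    rw [← zpow_natCast] at this
    rw [← two_mul, zpow_mul]
    simpa using congrArg (· ^ j) this
  refine mul_mem (mul_mem (c.mem_center ?_ ?_) (c.mem_center ?_ ?_)) (zpow_mem c.z_mem_center k)
  · exact Commute.zpow_right rfl a
  · have := c.y_zpow_mul_x_zpow a 1
    rw [hz _ (by simpa using ha)] at this
    have h : c.y * c.x ^ a = c.x ^ a * c.y := by simpa using this
    exact h
  · have := c.y_zpow_mul_x_zpow 1 b
    rw [hz _ (by simpa using hb)] at this
    have h : c.y ^ b * c.x = c.x * c.y ^ b := by simpa using this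
    exact h.symm
  · exact Commute.zpow_right rfl b

theorem exists_sq_eq (a b k : ℤ) : ∃ l : ℤ,
    (c.x ^ a * c.y ^ b * c.z ^ k) ^ 2 = c.x ^ (2 * a) * c.y ^ (2 * b) * c.z ^ l := by
  refine ⟨2 * k - a * b, ?_⟩
  have hc : ∀ (i : ℤ) (g : D), c.z ^ i * g = g * c.z ^ i :=
    fun i g => ((c.commute_z g).zpow_right i).symm.eq
  calc (c.x ^ a * c.y ^ b * c.z ^ k) ^ 2
      = c.x ^ a * c.y ^ b * (c.z ^ k * (c.x ^ a * c.y ^ b)) * c.z ^ k := by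
        rw [sq]; simp only [mul_assoc]
    _ = c.x ^ a * (c.y ^ b * c.x ^ a) * c.y ^ b * c.z ^ (2 * k) := by
        rw [hc, two_mul, zpow_add]; simp only [mul_assoc]
    _ = c.x ^ a * (c.z ^ (-(a * b)) * (c.x ^ a * c.y ^ b)) * c.y ^ b * c.z ^ (2 * k) := by
        rw [c.y_zpow_mul_x_zpow, mul_assoc (c.z ^ _)]
    _ = c.x ^ a * c.x ^ a * c.y ^ b * (c.z ^ (-(a * b)) * c.y ^ b) * c.z ^ (2 * k) := by
        rw [hc]; simp only [mul_assoc]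
    _ = _ := by
        rw [hc, two_mul a, two_mul b, show 2 * k - a * b = -(a * b) + 2 * k by ring,
          zpow_add c.z, zpow_add c.x, zpow_add c.y]
        simp only [mul_assoc]

/-- From the fourth power on, the commutator no longer contributes to `2`-powers. -/
theorem pow_two_pow_eq {j : ℕ} (hj : 2 ≤ j) (a b k : ℤ) :
    (c.x ^ a * c.y ^ b * c.z ^ k) ^ 2 ^ j = c.x ^ (2 ^ j * a) * c.y ^ (2 ^ j * b) := by
  obtain ⟨i, rfl⟩ := Nat.exists_eq_add_of_le hj
  obtain ⟨l, hl⟩ := c.exists_sq_eq a b k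
  have hcx : c.x ^ (2 * a) ∈ Subgroup.center D := by
    simpa using c.mem_center_of_even (even_two_mul a) (b := 0) (by simp) 0
  have h1 : Commute (c.x ^ (2 * a)) (c.y ^ (2 * b)) := (Subgroup.mem_center_iff.mp hcx _).symm
  have hz : (c.z ^ l) ^ 2 ^ (1 + i) = 1 := by
    rw [← zpow_natCast, zpow_comm, zpow_natCast, pow_add, pow_one, pow_mul, c.z_sq, one_pow,
      one_zpow]
  have h2 : 2 ^ (2 + i) = 2 * 2 ^ (1 + i) := by rw [← pow_succ']; congr 1; omega
  rw [h2, pow_mul, hl, ((c.commute_z _).zpow_right l).mul_pow, hz, mul_one, h1.mul_pow,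
    ← zpow_natCast, ← zpow_natCast, ← zpow_mul, ← zpow_mul]
  have h3 : (2 : ℤ) ^ (2 + i) = 2 * 2 ^ (1 + i) := by exact_mod_cast h2
  rw [h3]
  congr 2 <;> push_cast <;> ring

theorem finite (c : RedeiCoordinates D r s) : Finite D := by
  have fin : ∀ {g : D} {n : ℕ}, g ^ 2 ^ n = 1 → (Set.range fun i : ℤ => g ^ i).Finite := by
    intro g n h
    exact (isOfFinOrder_iff_pow_eq_one.mpr ⟨2 ^ n, by positivity, h⟩).finite_zpowers
  have h := Set.Finite.image2 (· * ·) (Set.Finite.image2 (· * ·) (fin c.x_pow) (fin c.y_pow))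
    (fin (n := 1) (by simpa using c.z_sq))
  refine Set.finite_univ_iff.mp (h.subset fun t _ => ?_)
  obtain ⟨a, b, k, rfl⟩ := c.exists_eq t
  exact ⟨_, ⟨_, ⟨a, rfl⟩, _, ⟨b, rfl⟩, rfl⟩, _, ⟨k, rfl⟩, rfl⟩

theorem isPGroup (c : RedeiCoordinates D r s) (hr : 2 ≤ r) (hsr : s ≤ r) : IsPGroup 2 D := by
  intro t
  obtain ⟨a, b, k, rfl⟩ := c.exists_eq t
  refine ⟨r, ?_⟩
  have hx := c.x_pow
  have hy : c.y ^ 2 ^ r = 1 := by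
    obtain ⟨i, rfl⟩ := Nat.exists_eq_add_of_le hsr
    rw [pow_add, pow_mul, c.y_pow, one_pow]
  rw [← zpow_natCast] at hx hy
  push_cast at hx hy
  rw [c.pow_two_pow_eq hr, zpow_mul, zpow_mul, hx, hy]
  simp

/-- An element of order at most `2` has coordinates divisible by `2 ^ (r - 1)`
and `2 ^ (s - 1)`. -/
theorem exists_eq_of_sq_eq_one (hr : 1 ≤ r) (hs : 1 ≤ s) {t : D} (ht : t ^ 2 = 1) :
    ∃ a b k : ℤ, t = c.x ^ (2 ^ (r - 1) * a) * c.y ^ (2 ^ (s - 1) * b) * c.z ^ k := by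
  obtain ⟨a, b, k, rfl⟩ := c.exists_eq t
  obtain ⟨l, hl⟩ := c.exists_sq_eq a b k
  rw [hl] at ht
  have hA := congrArg c.A ht
  have hB := congrArg c.B ht
  rw [c.A_apply, map_one, ofAdd_eq_one, ZMod.intCast_zmod_eq_zero_iff_dvd] at hA
  rw [c.B_apply, map_one, ofAdd_eq_one, ZMod.intCast_zmod_eq_zero_iff_dvd] at hB
  obtain ⟨r, rfl⟩ := Nat.exists_eq_add_of_le' hr
  obtain ⟨s, rfl⟩ := Nat.exists_eq_add_of_le' hs
  push_cast at hA hB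
  rw [pow_succ'] at hA hB
  obtain ⟨a, rfl⟩ := (mul_dvd_mul_iff_left (by norm_num : (2 : ℤ) ≠ 0)).mp hA
  obtain ⟨b, rfl⟩ := (mul_dvd_mul_iff_left (by norm_num : (2 : ℤ) ≠ 0)).mp hB
  exact ⟨a, b, k, rfl⟩

theorem mem_center_of_sq_eq_one (c : RedeiCoordinates D r s) (hr : 2 ≤ r) (hs : 2 ≤ s)
    {t : D} (ht : t ^ 2 = 1) : t ∈ Subgroup.center D := by
  obtain ⟨a, b, k, rfl⟩ := c.exists_eq_of_sq_eq_one (by omega) (by omega) ht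
  have h : ∀ {n : ℕ}, 2 ≤ n → ∀ i : ℤ, Even (2 ^ (n - 1) * i) := fun hn i =>
    (Even.pow_of_ne_zero even_two (by omega)).mul_right i
  exact c.mem_center_of_even (h hr a) (h hs b) k

/-- The reduction of the coordinates modulo `2`, a homomorphism whose kernel is central. -/
def parity (hr : 1 ≤ r) (hs : 1 ≤ s) : D →* Multiplicative (ZMod 2) × Multiplicative (ZMod 2) :=
  ((ZMod.castHom (dvd_pow_self 2 (by omega : r ≠ 0))
    (ZMod 2)).toAddMonoidHom.toMultiplicative.comp c.A).prod
  ((ZMod.castHom (dvd_pow_self 2 (by omega : s ≠ 0))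
    (ZMod 2)).toAddMonoidHom.toMultiplicative.comp c.B)

theorem parity_apply (hr : 1 ≤ r) (hs : 1 ≤ s) (a b k : ℤ) :
    c.parity hr hs (c.x ^ a * c.y ^ b * c.z ^ k) =
      (Multiplicative.ofAdd (a : ZMod 2), Multiplicative.ofAdd (b : ZMod 2)) := by
  have hA := c.A_apply a b k
  have hB := c.B_apply a b k
  ext
  · change Multiplicative.ofAdd
      (ZMod.castHom (dvd_pow_self 2 (by omega)) (ZMod 2) (c.A _).toAdd) = _
    rw [hA]; exact congrArg Multiplicative.ofAdd (map_intCast _ a)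
  · change Multiplicative.ofAdd
      (ZMod.castHom (dvd_pow_self 2 (by omega)) (ZMod 2) (c.B _).toAdd) = _
    rw [hB]; exact congrArg Multiplicative.ofAdd (map_intCast _ b)

theorem mem_center_of_parity_eq_one (hr : 1 ≤ r) (hs : 1 ≤ s) {t : D}
    (ht : c.parity hr hs t = 1) : t ∈ Subgroup.center D := by
  obtain ⟨a, b, k, rfl⟩ := c.exists_eq t
  rw [c.parity_apply, Prod.mk_eq_one, ofAdd_eq_one, ofAdd_eq_one, ZMod.intCast_eq_zero_iff_even,
    ZMod.intCast_eq_zero_iff_even] at ht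
  exact c.mem_center_of_even ht.1 ht.2 k

/-- A nonabelian subgroup covers `D / Z(D)`: two noncommuting elements have distinct nontrivial
parities, and these generate the four-group. -/
theorem abelian_or_covers_center_quotient (c : RedeiCoordinates D r s) (hr : 1 ≤ r)
    (hs : 1 ≤ s) (Q : Subgroup D) :
    (∀ a ∈ Q, ∀ b ∈ Q, a * b = b * a) ∨ ∀ g : D, ∃ q ∈ Q, q⁻¹ * g ∈ Subgroup.center D := by
  by_cases hQ : ∀ a ∈ Q, ∀ b ∈ Q, a * b = b * a
  · exact Or.inl hQ
  right
  push Not at hQ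
  obtain ⟨a, ha, b, hb, hab⟩ := hQ
  have four : ∀ u v w : Multiplicative (ZMod 2) × Multiplicative (ZMod 2),
      u = 1 ∨ v = 1 ∨ u = v ∨ w = 1 ∨ w = u ∨ w = v ∨ w = u * v :=
    (by decide : ∀ u v w : ZMod 2 × ZMod 2,
      u = 0 ∨ v = 0 ∨ u = v ∨ w = 0 ∨ w = u ∨ w = v ∨ w = u + v)
  have key : ∀ q g : D, c.parity hr hs g = c.parity hr hs q → q⁻¹ * g ∈ Subgroup.center D := by
    intro q g h
    apply c.mem_center_of_parity_eq_one hr hs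
    rw [map_mul, map_inv, h, inv_mul_cancel]
  have h1 : c.parity hr hs a ≠ 1 := fun h =>
    hab (Subgroup.mem_center_iff.mp (c.mem_center_of_parity_eq_one hr hs h) b).symm
  have h2 : c.parity hr hs b ≠ 1 := fun h =>
    hab (Subgroup.mem_center_iff.mp (c.mem_center_of_parity_eq_one hr hs h) a)
  have h3 : c.parity hr hs a ≠ c.parity hr hs b := fun h => hab (by
    have := Subgroup.mem_center_iff.mp (key a b h.symm) a
    rw [mul_inv_cancel_left, mul_assoc, eq_inv_mul_iff_mul_eq] at this
    exact this)
  intro g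
  rcases four (c.parity hr hs a) (c.parity hr hs b) (c.parity hr hs g) with
    h | h | h | h | h | h | h
  · exact absurd h h1
  · exact absurd h h2
  · exact absurd h h3
  · exact ⟨1, one_mem _, key 1 g (by rw [h, map_one])⟩
  · exact ⟨a, ha, key a g h⟩
  · exact ⟨b, hb, key b g h⟩
  · exact ⟨a * b, mul_mem ha hb, key (a * b) g (by rw [h, map_mul])⟩

/-! ### The automorphism group for `r > s` -/

/-- For `r > s` the power map `t ↦ t ^ 2 ^ (r - 1)` only sees the exponent of `x`. -/
theorem pow_two_pow_pred_eq (c : RedeiCoordinates D r s) (hs : 2 ≤ s) (hsr : s < r) (a b k : ℤ) :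
    (c.x ^ a * c.y ^ b * c.z ^ k) ^ 2 ^ (r - 1) = (c.x ^ 2 ^ (r - 1)) ^ a := by
  have hy : c.y ^ 2 ^ (r - 1) = 1 := by
    obtain ⟨i, hi⟩ := Nat.exists_eq_add_of_le (show s ≤ r - 1 by omega)
    rw [hi, pow_add, pow_mul, c.y_pow, one_pow]
  rw [c.pow_two_pow_eq (by omega), zpow_mul, zpow_mul]
  have h2 : (2 : ℤ) ^ (r - 1) = ((2 ^ (r - 1) : ℕ) : ℤ) := by push_cast; rfl
  rw [h2, zpow_natCast, zpow_natCast, hy, one_zpow, mul_one]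

theorem pow_two_pow_pred_eq_one_iff (c : RedeiCoordinates D r s) (hr : 1 ≤ r) (a : ℤ) :
    (c.x ^ 2 ^ (r - 1)) ^ a = 1 ↔ Even a := by
  obtain ⟨r, rfl⟩ := Nat.exists_eq_add_of_le' hr
  rw [← zpow_natCast, ← zpow_mul]
  constructor
  · intro h
    have hA := congrArg c.A (show c.x ^ (((2 ^ (r + 1 - 1) : ℕ) : ℤ) * a) * c.y ^ (0 : ℤ) *
      c.z ^ (0 : ℤ) = 1 by rw [h]; simp)
    rw [c.A_apply, map_one, ofAdd_eq_one, ZMod.intCast_zmod_eq_zero_iff_dvd] at hA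
    push_cast at hA
    rw [pow_succ, mul_dvd_mul_iff_left (by positivity)] at hA
    exact even_iff_two_dvd.mpr hA
  · rintro ⟨a, rfl⟩
    rw [← two_mul, ← mul_assoc]
    have : ((2 ^ (r + 1 - 1) : ℕ) : ℤ) * 2 = ((2 ^ (r + 1) : ℕ) : ℤ) := by
      push_cast; rw [pow_succ]
    rw [this, zpow_mul, zpow_natCast, c.x_pow, one_zpow]

/-- For `r > s ≥ 2` the identity is the only automorphism of odd order: successively it fixes
`x ^ 2 ^ (r - 1)` (the only nontrivial `2 ^ (r - 1)`-th power), `z` (which generates the commutator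
subgroup), all involutions, the central elements, and finally `y` and `x`. -/
theorem mulAut_eq_one_of_odd (c : RedeiCoordinates D r s) (hs : 2 ≤ s) (hsr : s < r)
    {α : MulAut D} {m : ℕ} (hm : Odd m) (hα : α ^ m = 1) : α = 1 := by
  have hP : IsPGroup 2 D := c.isPGroup (by omega) hsr.le
  have hpow := c.pow_two_pow_pred_eq hs hsr
  have hone := c.pow_two_pow_pred_eq_one_iff (by omega)
  have step : ∀ {t u : D}, α u = u → α t = t * u → α t = t := by
    intro t u hu h
    obtain ⟨k, hk⟩ := hP u
    rw [h, MulAut.eq_one_of_apply_eq_mul hm hα hu h hk, mul_one]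
  -- A power of an element of order at most `2` is determined by the parity of the exponent.
  have zpow_cases : ∀ {g : D}, g ^ 2 = 1 → ∀ i : ℤ, g ^ i = if Even i then 1 else g := by
    intro g hg i
    rw [← zpow_natCast] at hg
    split_ifs with hi
    · obtain ⟨j, rfl⟩ := hi
      rw [← two_mul, zpow_mul]
      exact (congrArg (· ^ j) hg).trans (one_zpow j)
    · obtain ⟨j, rfl⟩ := Int.not_even_iff_odd.mp hi
      rw [zpow_add, zpow_mul, zpow_one]
      exact (congrArg (· ^ j * g) hg).trans (by rw [one_zpow, one_mul])
  set X := c.x ^ 2 ^ (r - 1) with hX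
  set Y := c.y ^ 2 ^ (s - 1) with hY
  have hX2 : X ^ 2 = 1 := by rw [hX, ← pow_mul, ← pow_succ, Nat.sub_add_cancel (by omega), c.x_pow]
  have hY2 : Y ^ 2 = 1 := by rw [hY, ← pow_mul, ← pow_succ, Nat.sub_add_cancel (by omega), c.y_pow]
  have hXne : X ≠ 1 := fun h => absurd ((hone 1).mp (by rw [zpow_one]; exact h)) (by decide)
  -- `α X` is again a `2 ^ (r - 1)`-th power, and these are `1` and `X`.
  have hαX : α X = X := by
    obtain ⟨a, b, k, h⟩ := c.exists_eq (α c.x)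
    have h1 : α X = X ^ a := by rw [hX, map_pow, h, hpow]
    rw [zpow_cases hX2] at h1
    split_ifs at h1
    · exact absurd ((map_eq_one_iff α α.injective).mp h1) hXne
    · exact h1
  have hαz : α c.z = c.z := by
    have hmem : α c.z ∈ Subgroup.zpowers c.z := by
      rw [← c.commutator, map_commutatorElement, c.commutator]
      apply c.mem_zpowers_z <;>
        rw [map_commutatorElement, commutatorElement_eq_one_iff_commute] <;> exact Commute.all _ _
    obtain ⟨k, hk⟩ := hmem
    change c.z ^ k = α c.z at hk
    rw [zpow_cases c.z_sq] at hk
    split_ifs at hk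
    · rw [(map_eq_one_iff α α.injective).mp hk.symm, map_one]
    · exact hk.symm
  have inv_eq : ∀ {t : D}, t ^ 2 = 1 → ∃ a b k : ℤ, t = X ^ a * Y ^ b * c.z ^ k := by
    intro t ht
    obtain ⟨a, b, k, h⟩ := c.exists_eq_of_sq_eq_one (by omega) (by omega) ht
    refine ⟨a, b, k, ?_⟩
    rw [h, zpow_mul, zpow_mul, hX, hY, ← zpow_natCast, ← zpow_natCast]
    push_cast
    rfl
  have hXz : ∀ a k : ℤ, α (X ^ a * c.z ^ k) = X ^ a * c.z ^ k := by
    intro a k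
    rw [map_mul, map_zpow, map_zpow, hαX, hαz]
  have hαY : α Y = Y := by
    obtain ⟨a, b, k, h⟩ := inv_eq (t := α Y) (by rw [← map_pow, hY2, map_one])
    rw [zpow_cases hY2] at h
    -- If `b` is even, `α Y` is a fixed element `X ^ a * z ^ k`; otherwise `α Y` is `Y` times one.
    split_ifs at h
    · rw [mul_one] at h
      have := α.injective (h.trans (hXz a k).symm)
      rw [this, hXz]
    · refine step (hXz a k) ?_
      have hXc : X ∈ Subgroup.center D := c.mem_center_of_sq_eq_one (by omega) hs hX2
      rw [h, ← Subgroup.mem_center_iff.mp (zpow_mem hXc a) Y, mul_assoc]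
  have hinv : ∀ u : D, u ^ 2 = 1 → α u = u := by
    intro u hu
    obtain ⟨a, b, k, rfl⟩ := inv_eq hu
    simp only [map_mul, map_zpow, hαX, hαY, hαz]
  have hcenter : ∀ t ∈ Subgroup.center D, α t = t := by
    intro t ht
    obtain ⟨k, hk⟩ := hP t
    exact MulAut.apply_eq_of_commute hm hα hinv (Subgroup.mem_center_iff.mp ht (α t)).symm hk
  have hy : α c.y = c.y := by
    obtain ⟨a, b, k, h⟩ := c.exists_eq (α c.y)
    -- The elements with an even exponent of `x` are those with trivial `2 ^ (r - 1)`-th power.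
    have ha : Even a := by
      rw [← hone, ← hpow a b k, ← h, ← map_pow]
      have := hpow 0 1 0
      simp only [zpow_zero, zpow_one, one_mul, mul_one] at this
      rw [this, map_one]
    rcases Int.even_or_odd b with hb | ⟨b, rfl⟩
    · have := hcenter _ (c.mem_center_of_even ha hb k)
      rw [← h] at this
      exact α.injective this
    · have hc := c.mem_center_of_even ha (even_two_mul b) k
      refine step (hcenter _ hc) ?_
      have hxc : c.x ^ a ∈ Subgroup.center D := by
        simpa using c.mem_center_of_even ha (b := 0) (by simp) 0
      rw [h, add_comm, zpow_one_add, ← mul_assoc (c.x ^ a), ← Subgroup.mem_center_iff.mp hxc]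
      simp only [mul_assoc]
  have hx : α c.x = c.x := by
    obtain ⟨a, b, k, h⟩ := c.exists_eq (α c.x)
    rcases Int.even_or_odd a with ha | ⟨a, rfl⟩
    · rw [← hone, ← hpow a b k, ← h, ← map_pow] at ha
      exact absurd ((map_eq_one_iff α α.injective).mp ha) hXne
    · refine step (u := c.x ^ (2 * a) * c.y ^ b * c.z ^ k) ?_ ?_
      · rw [map_mul, map_mul, map_zpow α c.y, hy, map_zpow α c.z, hαz]
        congr 2
        apply hcenter
        simpa using c.mem_center_of_even (even_two_mul a) (b := 0) (by simp) 0
      · rw [h, add_comm, zpow_one_add]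
        simp only [mul_assoc]
  ext t
  obtain ⟨a, b, k, rfl⟩ := c.exists_eq t
  simp only [map_mul, map_zpow, hx, hy, hαz, MulAut.one_apply]

theorem isPGroup_mulAut (c : RedeiCoordinates D r s) (hs : 2 ≤ s) (hsr : s < r) :
    IsPGroup 2 (MulAut D) := by
  have := c.finite
  exact IsPGroup.of_odd_pow_eq_one fun _ _ hm hα => c.mulAut_eq_one_of_odd hs hsr hm hα

end RedeiCoordinates

/-! ### Saturated fusion systems on the minimal nonabelian group -/

theorem mainTheorem6 {D : Type*} [Group D] (r s : ℕ) (hs : 1 ≤ s) (hsr : s ≤ r)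
    (hD : Nonempty (D ≃* RedeiGroup r s)) (F : FusionSystem D) (hF : F.IsSaturated 2) :
    (F.IsNilpotent ∨ s = 1 ∨ r = s) ∧ (r = s → 2 ≤ r → F.IsControlled) := by
  obtain ⟨e⟩ := hD
  obtain ⟨c₀⟩ := RedeiGroup.nonempty_coordinates r s
  let c : RedeiCoordinates D r s := c₀.ofMulEquiv e
  have := c.finite
  have hc : 2 ≤ s → F.IsControlled := fun hs2 =>
    hF.isControlled (c.isPGroup (by omega) hsr)
      (fun _ ht => c.mem_center_of_sq_eq_one (by omega) hs2 ht)
      (c.abelian_or_covers_center_quotient (by omega) hs)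
  refine ⟨?_, fun h hr => hc (h ▸ hr)⟩
  by_cases h1 : s = 1
  · exact Or.inr (Or.inl h1)
  by_cases h2 : r = s
  · exact Or.inr (Or.inr h2)
  left
  exact hF.isNilpotent_of_isControlled (hc (by omega))
    ((c.ofMulEquiv Subgroup.topEquiv).isPGroup_mulAut (by omega) (by omega))
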